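/- Let $\mathbb{H}=\{z\in\mathbb{C}:\operatorname{Im}z>0\}$ with the hyperbolic distance $$d_{\mathbb H}(z,w)=\tfrac12\log\frac{1+\rho(z,w)}{1-\rho(z,w)},\qquad \rho(z,w)=\left|\frac{z-w}{z-\overline w}\right|.$$ Let $f:\mathbb{H}\to\mathbb{H}$ be a hyperbolic holomorphic self-map with Denjoy–Wolff point $\infty$; that is, $f$ is holomorphic and has no fixed point, its iterates $f^n$ converge to $\infty$ locally uniformly on $\mathbb{H}$, and the angular (non-tangential) limit $\alpha:=f'(\infty):=\angle\lim_{z\to\infty}f(z)/z$ is a real number with $\alpha>1$. Say that $f$ is of extremal rate if $\lim_{n\to\infty}f^n(z)/\alpha^n$ exists and lies in $\mathbb{H}$ for some $z\in\mathbb{H}$. Then $f$ is of extremal rate if and only if the limit $$\lim_{n\to+\infty}\left(d_{\mathbb H}(i,f^n(z))-\frac{\log\alpha}{2}\,n\right)$$ exists in $\mathbb{R}$ for all $z\in\mathbb{H}$. Moreover, if either condition is met, then the limit $L(z)=\lim_{n\to\infty}f^n(z)/\alpha^n$ exists in $\mathbb{H}$ for every $z\in\mathbb{H}$, the sequence $f^n(z)/|f^n(i)|$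 converges locally uniformly on $\mathbb{H}$ to a map $h:\mathbb{H}\to\mathbb{H}$ (the Koenigs function of $f$), and $$\lim_{n\to+\infty}\left(d_{\mathbb H}(i,f^n(z))-\frac{\log\alpha}{2}\,n\right)=\frac12\log\left(\frac{|h(z)\,L(i)|}{\sin(\arg h(z))}\right)\qquad\text{for all }z\in\mathbb{H}.$$ -/

import Mathlib

open Filter Topology UpperHalfPlane

noncomputable section

namespace HalfPlaneDynamics

/-- The pseudo-hyperbolic distance `|(z - w) / (z - conj w)|` of the upper half-plane. -/
def pseudoHypDist (z w : ℍ) : ℝ :=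
  ‖((z : ℂ) - (w : ℂ)) / ((z : ℂ) - (starRingEnd ℂ) (w : ℂ))‖

/-- The hyperbolic distance `(1/2) log ((1 + ρ) / (1 - ρ))` of the upper half-plane, normalized to
curvature `-4`. (It is one half of the distance that Mathlib puts on `ℍ`.) -/
def hypDist (z w : ℍ) : ℝ :=
  1 / 2 * Real.log ((1 + pseudoHypDist z w) / (1 - pseudoHypDist z w))

/-- The filter on `ℍ` of the approach to `∞` inside the sector `δ * |z| ≤ Im z`. -/
def sectorAtInfty (δ : ℝ) : Filter ℍ :=
  comap (fun z : ℍ => (z : ℂ)) (Bornology.cobounded ℂ) ⊓ 𝓟 {z : ℍ | δ * ‖(z : ℂ)‖ ≤ z.im}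

/-- The angular (non-tangential) limit of `g` at `∞` is `c`: the limit of `g` at `∞` is `c` along
every sector `δ * |z| ≤ Im z`, `δ > 0`. -/
def HasAngularLimitAtInfty (g : ℍ → ℂ) (c : ℂ) : Prop :=
  ∀ δ : ℝ, 0 < δ → Tendsto g (sectorAtInfty δ) (𝓝 c)

/-- `f` has Denjoy–Wolff point `∞`: `f` has no fixed point, and the iterates of `f` converge to `∞`
locally uniformly on `ℍ`. -/
def HasDenjoyWolffPointInfty (f : ℍ → ℍ) : Prop :=
  (∀ z : ℍ, f z ≠ z) ∧
    ∀ w : ℍ, Tendsto (fun p : ℕ × ℍ => ((f^[p.1] p.2 : ℍ) : ℂ)) (atTop ×ˢ 𝓝 w)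
      (Bornology.cobounded ℂ)

/-- `f` is a hyperbolic holomorphic self-map of `ℍ` with Denjoy–Wolff point `∞` and angular
derivative `f'(∞) = ∠lim f(z) / z = α > 1` there. -/
structure IsHyperbolicAtInfty (f : ℍ → ℍ) (α : ℝ) : Prop where
  holomorphic : DifferentiableOn ℂ (fun z : ℂ => ((f (ofComplex z) : ℍ) : ℂ)) {z : ℂ | 0 < z.im}
  denjoyWolff : HasDenjoyWolffPointInfty f
  angularDeriv : HasAngularLimitAtInfty (fun z : ℍ => (f z : ℂ) / (z : ℂ)) (α : ℂ)
  one_lt : 1 < α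

/-- `f` is of extremal rate: `lim f^n(z) / α^n` exists and lies in `ℍ`, for some `z`. -/
def IsExtremalRate (f : ℍ → ℍ) (α : ℝ) : Prop :=
  ∃ z l : ℍ, Tendsto (fun n : ℕ => ((f^[n] z : ℍ) : ℂ) / (α : ℂ) ^ n) atTop (𝓝 (l : ℂ))

/-- `L(z) = lim f^n(z) / α^n` for every `z`, with values in `ℍ`. -/
def IsRateFunction (f : ℍ → ℍ) (α : ℝ) (L : ℍ → ℍ) : Prop :=
  ∀ z : ℍ, Tendsto (fun n : ℕ => ((f^[n] z : ℍ) : ℂ) / (α : ℂ) ^ n) atTop (𝓝 (L z : ℂ))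

/-- `h` is the Koenigs function of `f`: the locally uniform limit of `f^n(z) / |f^n(i)|`. -/
def IsKoenigsFunction (f h : ℍ → ℍ) : Prop :=
  TendstoLocallyUniformly
    (fun (n : ℕ) (z : ℍ) => ((f^[n] z : ℍ) : ℂ) / (‖((f^[n] UpperHalfPlane.I : ℍ) : ℂ)‖ : ℂ))
    (fun z : ℍ => (h z : ℂ)) atTop

end HalfPlaneDynamics

end

noncomputable section

namespace HalfPlaneDynamics

/-! ### The Schwarz–Pick lemma in the upper half-plane -/

/-! Put `g_n = f^n / α^n`. Dilations are isometries, so Schwarz–Pick makes each `g_n` nonexpanding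
and the distance between two orbits nonincreasing; Julia's lemma makes `Im g_n(z)` nondecreasing. If
`g_n(z)` is bounded, then `Im g_n(z)` converges to a positive number and `f^n(z)` stays in a sector,
so the angular derivative gives `g_{n+1}(z) - g_n(z) → 0`. Hence `Re g_n(z)` converges as soon as
its square does, possibly after subtracting a convergent sequence: vanishing steps cannot keep
switching sign. The square comes from the distance to a convergent orbit (one point implies all
points), or from `exp (2 (d(i, f^n z) - n log α / 2)) = M_n² / Im g_n(z)` with `M_n - |g_n(z)| → 0`
(distance limit implies extremal rate). The latter identity also gives the formula, with `h = L /
|L(i)|`. -/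

theorem pseudoHypDist_eq_tanh (z w : ℍ) : pseudoHypDist z w = Real.tanh (dist z w / 2) := by
  rw [UpperHalfPlane.tanh_half_dist, pseudoHypDist, norm_div, dist_eq_norm, dist_eq_norm]

theorem hypDist_eq_half_dist (z w : ℍ) : hypDist z w = dist z w / 2 := by
  have h := Real.artanh_eq_half_log (x := Real.tanh (dist z w / 2))
    ⟨(Real.neg_one_lt_tanh _).le, (Real.tanh_lt_one _).le⟩
  rw [hypDist, pseudoHypDist_eq_tanh, ← h, Real.artanh_tanh]

theorem pseudoHypDist_lt_one (z w : ℍ) : pseudoHypDist z w < 1 := by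
  rw [pseudoHypDist_eq_tanh]
  exact Real.tanh_lt_one _

theorem coe_sub_conj_ne_zero (z w : ℍ) : (z : ℂ) - (starRingEnd ℂ) (w : ℂ) ≠ 0 := by
  intro h
  have := congrArg Complex.im h
  simp only [Complex.sub_im, Complex.conj_im, coe_im, Complex.zero_im] at this
  linarith [z.im_pos, w.im_pos]

/-- The inverse of the Cayley transform of `ℍ` that sends `w` to `0`. -/
def cayleyInv (w : ℍ) (ζ : ℂ) : ℂ := ((w : ℂ) - (starRingEnd ℂ) (w : ℂ) * ζ) / (1 - ζ)

theorem one_sub_ne_zero_of_norm_lt_one {ζ : ℂ} (hζ : ‖ζ‖ < 1) : 1 - ζ ≠ 0 := by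
  intro h
  rw [← sub_eq_zero.1 h] at hζ
  simp at hζ

theorem cayleyInv_im_pos (w : ℍ) {ζ : ℂ} (hζ : ‖ζ‖ < 1) : 0 < (cayleyInv w ζ).im := by
  have h1 := one_sub_ne_zero_of_norm_lt_one hζ
  have hn : 0 < Complex.normSq (1 - ζ) := Complex.normSq_pos.2 h1
  have hζ2 : Complex.normSq ζ < 1 := by
    rw [Complex.normSq_eq_norm_sq]
    nlinarith [norm_nonneg ζ]
  have key : (cayleyInv w ζ).im = w.im * (1 - Complex.normSq ζ) / Complex.normSq (1 - ζ) := by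
    rw [cayleyInv, Complex.div_im]
    field_simp
    simp only [Complex.normSq_apply, Complex.sub_im, Complex.sub_re, Complex.mul_im,
      Complex.mul_re, Complex.conj_im, Complex.conj_re, coe_im, coe_re, Complex.one_im,
      Complex.one_re]
    ring
  rw [key]
  exact div_pos (mul_pos w.im_pos (by linarith)) hn

theorem cayleyInv_zero (w : ℍ) : cayleyInv w 0 = w := by simp [cayleyInv]

theorem cayleyInv_cayley (z w : ℍ) :
    cayleyInv w (((z : ℂ) - (w : ℂ)) / ((z : ℂ) - (starRingEnd ℂ) (w : ℂ))) = z := by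
  have h := coe_sub_conj_ne_zero z w
  have hw := coe_sub_conj_ne_zero w w
  have h1 : (1 : ℂ) - ((z : ℂ) - (w : ℂ)) / ((z : ℂ) - (starRingEnd ℂ) (w : ℂ))
      = ((w : ℂ) - (starRingEnd ℂ) (w : ℂ)) / ((z : ℂ) - (starRingEnd ℂ) (w : ℂ)) := by
    field_simp
    ring
  rw [cayleyInv, h1]
  field_simp
  ring

theorem differentiableOn_cayleyInv (w : ℍ) :
    DifferentiableOn ℂ (cayleyInv w) (Metric.ball 0 1) := by
  unfold cayleyInv
  refine DifferentiableOn.div (by fun_prop) (by fun_prop) fun ζ hζ ↦ ?_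
  exact one_sub_ne_zero_of_norm_lt_one (by simpa using hζ)

variable {f : ℍ → ℍ}

/-- The **Schwarz–Pick lemma** for the pseudo-hyperbolic distance of the upper half-plane. -/
theorem pseudoHypDist_map_le
    (hf : DifferentiableOn ℂ (fun z : ℂ => ((f (ofComplex z) : ℍ) : ℂ)) {z : ℂ | 0 < z.im})
    (z w : ℍ) : pseudoHypDist (f z) (f w) ≤ pseudoHypDist z w := by
  -- Conjugating `f` by the Cayley transforms at `w` and `f w` gives a disc map fixing `0`, to which
  -- the Schwarz lemma applies.
  set g : ℂ → ℂ := fun ζ ↦ ((f (ofComplex (cayleyInv w ζ)) : ℂ) - (f w : ℂ)) /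
    ((f (ofComplex (cayleyInv w ζ)) : ℂ) - (starRingEnd ℂ) (f w : ℂ)) with hg
  have hmaps : Set.MapsTo (cayleyInv w) (Metric.ball 0 1) {z : ℂ | 0 < z.im} := fun ζ hζ ↦
    cayleyInv_im_pos w (by simpa using hζ)
  have hd : DifferentiableOn ℂ g (Metric.ball 0 1) := by
    have hc := hf.comp (differentiableOn_cayleyInv w) hmaps
    exact (hc.sub_const _).div (hc.sub_const _) fun ζ _ ↦ coe_sub_conj_ne_zero _ _
  have hball : Set.MapsTo g (Metric.ball 0 1) (Metric.closedBall 0 1) := fun ζ _ ↦ by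
    rw [mem_closedBall_zero_iff]
    exact (pseudoHypDist_lt_one (f (ofComplex (cayleyInv w ζ))) (f w)).le
  have h0 : g 0 = 0 := by simp [hg, cayleyInv_zero]
  have := Complex.norm_le_norm_of_mapsTo_ball hd hball h0 (pseudoHypDist_lt_one z w)
  simpa [hg, cayleyInv_cayley, pseudoHypDist] using this

/-- The **Schwarz–Pick lemma**: a holomorphic self-map of `ℍ` does not increase distances. -/
theorem dist_map_le
    (hf : DifferentiableOn ℂ (fun z : ℂ => ((f (ofComplex z) : ℍ) : ℂ)) {z : ℂ | 0 < z.im})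
    (z w : ℍ) : dist (f z) (f w) ≤ dist z w := by
  have h := pseudoHypDist_map_le hf z w
  rw [pseudoHypDist_eq_tanh, pseudoHypDist_eq_tanh] at h
  have := Real.artanh_le_artanh (Real.neg_one_lt_tanh _) (Real.tanh_lt_one _) h
  rw [Real.artanh_tanh, Real.artanh_tanh] at this
  linarith

/-- Schwarz–Pick read through `cosh`, free of denominators, so that it can be rescaled as `w → ∞` in
Julia's lemma. -/
theorem dist_coe_sq_mul_le
    (hf : DifferentiableOn ℂ (fun z : ℂ => ((f (ofComplex z) : ℍ) : ℂ)) {z : ℂ | 0 < z.im})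
    (z w : ℍ) : ‖(f z : ℂ) - f w‖ ^ 2 * (z.im * w.im) ≤
      ‖(z : ℂ) - w‖ ^ 2 * ((f z).im * (f w).im) := by
  have h := Real.cosh_strictMonoOn.monotoneOn dist_nonneg dist_nonneg (dist_map_le hf z w)
  rw [UpperHalfPlane.cosh_dist, UpperHalfPlane.cosh_dist, add_le_add_iff_left,
    div_le_div_iff₀ (by positivity) (by positivity), dist_eq_norm, dist_eq_norm] at h
  linarith

/-! ### Julia's lemma at infinity -/

/-- The point `(n + 1) i` of the imaginary axis. -/
def imagPoint (n : ℕ) : ℍ := ⟨((n + 1 : ℝ) : ℂ) * Complex.I, by simp; positivity⟩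

theorem coe_imagPoint (n : ℕ) : (imagPoint n : ℂ) = ((n + 1 : ℝ) : ℂ) * Complex.I := rfl

theorem imagPoint_im (n : ℕ) : (imagPoint n).im = n + 1 := by
  rw [← coe_im, coe_imagPoint, Complex.im_ofReal_mul, Complex.I_im, mul_one]

theorem norm_imagPoint (n : ℕ) : ‖(imagPoint n : ℂ)‖ = n + 1 := by
  rw [coe_imagPoint, norm_mul, Complex.norm_I, mul_one, Complex.norm_real, Real.norm_eq_abs,
    abs_of_nonneg (by positivity)]

theorem tendsto_imagPoint : Tendsto imagPoint atTop (sectorAtInfty 1) := by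
  refine tendsto_inf.2 ⟨tendsto_comap_iff.2 ?_, tendsto_principal.2 (Eventually.of_forall ?_)⟩
  · rw [← tendsto_norm_atTop_iff_cobounded]
    simpa only [Function.comp_def, norm_imagPoint] using
      tendsto_natCast_atTop_atTop.atTop_add (tendsto_const_nhds (x := (1 : ℝ)))
  · intro n
    simp [norm_imagPoint, imagPoint_im]

/-- **Julia's lemma** at `∞`. -/
theorem mul_im_le_im_map {α : ℝ} (hα : 0 < α)
    (hf : DifferentiableOn ℂ (fun z : ℂ => ((f (ofComplex z) : ℍ) : ℂ)) {z : ℂ | 0 < z.im})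
    (hang : HasAngularLimitAtInfty (fun z : ℍ => (f z : ℂ) / (z : ℂ)) (α : ℂ)) (z : ℍ) :
    α * z.im ≤ (f z).im := by
  have hinv : Tendsto (fun n : ℕ ↦ (((n + 1 : ℝ) : ℂ))⁻¹) atTop (𝓝 0) := by
    have h : Tendsto (fun n : ℕ ↦ ((n : ℝ) + 1)⁻¹) atTop (𝓝 0) :=
      tendsto_inv_atTop_zero.comp
        (tendsto_natCast_atTop_atTop.atTop_add (tendsto_const_nhds (x := (1 : ℝ))))
    simpa only [Complex.ofReal_inv, Complex.ofReal_zero, Function.comp_def] using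
      (Complex.continuous_ofReal.tendsto 0).comp h
  have hp : Tendsto (fun n ↦ (f (imagPoint n) : ℂ) * ((n + 1 : ℝ) : ℂ)⁻¹) atTop
      (𝓝 (α * Complex.I)) := by
    refine (((hang 1 one_pos).comp tendsto_imagPoint).mul_const Complex.I).congr fun n ↦ ?_
    have hn : ((n + 1 : ℝ) : ℂ) ≠ 0 := by exact_mod_cast n.succ_ne_zero
    have hI := Complex.I_ne_zero
    simp only [Function.comp_apply, coe_imagPoint]
    field_simp
  have hleft : Tendsto (fun n : ℕ ↦ ‖(f z : ℂ) * ((n + 1 : ℝ) : ℂ)⁻¹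
      - (f (imagPoint n) : ℂ) * ((n + 1 : ℝ) : ℂ)⁻¹‖ ^ 2 * z.im) atTop (𝓝 (α ^ 2 * z.im)) := by
    have := ((((hinv.const_mul (f z : ℂ)).sub hp).norm).pow 2).mul_const z.im
    simpa [abs_of_pos hα] using this
  have hright : Tendsto (fun n : ℕ ↦ ‖(z : ℂ) * ((n + 1 : ℝ) : ℂ)⁻¹ - Complex.I‖ ^ 2 *
      ((f z).im * ((f (imagPoint n) : ℂ) * ((n + 1 : ℝ) : ℂ)⁻¹).im)) atTop
      (𝓝 ((f z).im * α)) := by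
    have := ((((hinv.const_mul (z : ℂ)).sub_const Complex.I).norm).pow 2).mul
      (((Complex.continuous_im.tendsto _).comp hp).const_mul (f z).im)
    simpa using this
  -- The inequality at `w = (n + 1) i`, divided by `(n + 1) ^ 3`, tends to `α² Im z ≤ α Im f(z)`.
  have hle := le_of_tendsto_of_tendsto' hleft hright fun n : ℕ ↦ ?_
  · nlinarith
  · have hn : (0 : ℝ) < n + 1 := by positivity
    have hnc : ((n + 1 : ℝ) : ℂ) ≠ 0 := by exact_mod_cast hn.ne'
    have h := dist_coe_sq_mul_le hf z (imagPoint n)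
    have e1 : ‖(f z : ℂ) * ((n + 1 : ℝ) : ℂ)⁻¹ - (f (imagPoint n) : ℂ) * ((n + 1 : ℝ) : ℂ)⁻¹‖
        = ‖(f z : ℂ) - f (imagPoint n)‖ / (n + 1) := by
      rw [← sub_mul, norm_mul, norm_inv, Complex.norm_real, Real.norm_of_nonneg hn.le,
        div_eq_mul_inv]
    have e2 : ‖(z : ℂ) * ((n + 1 : ℝ) : ℂ)⁻¹ - Complex.I‖ = ‖(z : ℂ) - imagPoint n‖ / (n + 1) := by
      have : (z : ℂ) * ((n + 1 : ℝ) : ℂ)⁻¹ - Complex.I =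
          ((z : ℂ) - imagPoint n) / ((n + 1 : ℝ) : ℂ) := by
        rw [coe_imagPoint, sub_div, mul_div_cancel_left₀ _ hnc, div_eq_mul_inv]
      rw [this, norm_div, Complex.norm_real, Real.norm_of_nonneg hn.le]
    have e3 : ((f (imagPoint n) : ℂ) * ((n + 1 : ℝ) : ℂ)⁻¹).im = (f (imagPoint n)).im / (n + 1) := by
      rw [← Complex.ofReal_inv, Complex.im_mul_ofReal, coe_im, div_eq_mul_inv]
    rw [imagPoint_im] at h
    rw [e1, e2, e3, div_pow, div_pow]
    rw [div_mul_eq_mul_div, mul_div_assoc', div_mul_div_comm, div_le_div_iff₀ (by positivity)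
      (by positivity)]
    have := mul_le_mul_of_nonneg_right h (by positivity : 0 ≤ ((n : ℝ) + 1) ^ 2)
    linarith

end HalfPlaneDynamics

end
noncomputable section

namespace HalfPlaneDynamics

/-! ### Rescaled iterates -/

/-- If `c > 0`, eventually `|a n| > √c / 2` while the steps are shorter than `√c`, so the sign of `a
n` is frozen. -/
theorem exists_tendsto_of_tendsto_sq {a : ℕ → ℝ} {c : ℝ}
    (hsq : Tendsto (fun n ↦ a n ^ 2) atTop (𝓝 c))
    (hdiff : Tendsto (fun n ↦ a (n + 1) - a n) atTop (𝓝 0)) :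
    ∃ l, Tendsto a atTop (𝓝 l) := by
  have habs : Tendsto (fun n ↦ |a n|) atTop (𝓝 √c) := by
    simpa only [Real.sqrt_sq_eq_abs] using hsq.sqrt
  rcases (Real.sqrt_nonneg c).eq_or_lt with h0 | hpos
  · exact ⟨0, (tendsto_zero_iff_abs_tendsto_zero _).2 (h0 ▸ habs)⟩
  · obtain ⟨N, hN⟩ := eventually_atTop.1 ((habs.eventually_const_lt (half_lt_self hpos)).and
      ((tendsto_zero_iff_abs_tendsto_zero _).1 hdiff |>.eventually_lt_const hpos))
    rcases le_or_gt 0 (a N) with hs | hs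
    · have hall : ∀ n, N ≤ n → 0 ≤ a n := fun n hn ↦ by
        induction n, hn using Nat.le_induction with
        | base => exact hs
        | succ n hn ih =>
          obtain ⟨h1, h2⟩ := hN n hn
          obtain ⟨h3, -⟩ := hN (n + 1) (by omega)
          by_contra! hneg
          rw [Function.comp_apply, abs_lt] at h2
          rw [abs_of_nonneg ih] at h1
          rw [abs_of_neg hneg] at h3
          linarith
      exact ⟨√c, habs.congr' (eventually_atTop.2 ⟨N, fun n hn ↦ abs_of_nonneg (hall n hn)⟩)⟩
    · have hall : ∀ n, N ≤ n → a n < 0 := fun n hn ↦ by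
        induction n, hn using Nat.le_induction with
        | base => exact hs
        | succ n hn ih =>
          obtain ⟨h1, h2⟩ := hN n hn
          obtain ⟨h3, -⟩ := hN (n + 1) (by omega)
          by_contra! hneg
          rw [Function.comp_apply, abs_lt] at h2
          rw [abs_of_neg ih] at h1
          rw [abs_of_nonneg hneg] at h3
          linarith
      refine ⟨-√c, habs.neg.congr' (eventually_atTop.2 ⟨N, fun n hn ↦ ?_⟩)⟩
      rw [abs_of_neg (hall n hn), neg_neg]

/-- The rescaled iterate `f^n(z) / α^n`, as a point of `ℍ`. -/
def rescaledIterate (f : ℍ → ℍ) {α : ℝ} (hα : 0 < α) (n : ℕ) (z : ℍ) : ℍ :=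
  (⟨(α ^ n)⁻¹, by positivity⟩ : {x : ℝ // 0 < x}) • f^[n] z

section rescaledIterate

variable {f : ℍ → ℍ} {α : ℝ}

theorem coe_rescaledIterate (hα : 0 < α) (n : ℕ) (z : ℍ) :
    (rescaledIterate f hα n z : ℂ) = (f^[n] z : ℂ) / (α : ℂ) ^ n := by
  rw [rescaledIterate, coe_pos_real_smul, Complex.real_smul]
  push_cast
  rw [div_eq_inv_mul]

theorem rescaledIterate_im (hα : 0 < α) (n : ℕ) (z : ℍ) :
    (rescaledIterate f hα n z).im = (f^[n] z).im / α ^ n := by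
  rw [rescaledIterate, pos_real_im, div_eq_inv_mul]

theorem norm_rescaledIterate (hα : 0 < α) (n : ℕ) (z : ℍ) :
    ‖(rescaledIterate f hα n z : ℂ)‖ = ‖(f^[n] z : ℂ)‖ / α ^ n := by
  rw [coe_rescaledIterate, norm_div, norm_pow, Complex.norm_real, Real.norm_of_nonneg hα.le]

theorem rescaledIterate_zero (hα : 0 < α) (z : ℍ) : rescaledIterate f hα 0 z = z := by
  ext
  simp [coe_rescaledIterate]

theorem tendsto_rescaledIterate_iff (hα : 0 < α) {z l : ℍ} :
    Tendsto (fun n ↦ rescaledIterate f hα n z) atTop (𝓝 l) ↔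
      Tendsto (fun n : ℕ => ((f^[n] z : ℍ) : ℂ) / (α : ℂ) ^ n) atTop (𝓝 (l : ℂ)) := by
  rw [isEmbedding_coe.tendsto_nhds_iff]
  simp only [Function.comp_def, coe_rescaledIterate]

theorem dist_rescaledIterate (hα : 0 < α) (n : ℕ) (z w : ℍ) :
    dist (rescaledIterate f hα n z) (rescaledIterate f hα n w) = dist (f^[n] z) (f^[n] w) :=
  (isometry_pos_mul _).dist_eq _ _

theorem IsHyperbolicAtInfty.pos (hf : IsHyperbolicAtInfty f α) : 0 < α := one_pos.trans hf.one_lt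

theorem IsHyperbolicAtInfty.dist_iterate_le (hf : IsHyperbolicAtInfty f α) (n : ℕ) (z w : ℍ) :
    dist (f^[n] z) (f^[n] w) ≤ dist z w := by
  induction n with
  | zero => simp
  | succ n ih =>
    rw [Function.iterate_succ_apply', Function.iterate_succ_apply']
    exact (dist_map_le hf.holomorphic _ _).trans ih

theorem IsHyperbolicAtInfty.dist_rescaledIterate_le (hf : IsHyperbolicAtInfty f α) (n : ℕ) (z w : ℍ) :
    dist (rescaledIterate f hf.pos n z) (rescaledIterate f hf.pos n w) ≤ dist z w := by
  rw [dist_rescaledIterate]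
  exact hf.dist_iterate_le n z w

theorem IsHyperbolicAtInfty.antitone_dist_rescaledIterate (hf : IsHyperbolicAtInfty f α) (z w : ℍ) :
    Antitone fun n ↦ dist (rescaledIterate f hf.pos n z) (rescaledIterate f hf.pos n w) := by
  refine antitone_nat_of_succ_le fun n ↦ ?_
  simp only [dist_rescaledIterate, Function.iterate_succ_apply']
  exact dist_map_le hf.holomorphic _ _

theorem IsHyperbolicAtInfty.monotone_rescaledIterate_im (hf : IsHyperbolicAtInfty f α) (z : ℍ) :
    Monotone fun n ↦ (rescaledIterate f hf.pos n z).im := by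
  refine monotone_nat_of_le_succ fun n ↦ ?_
  have := mul_im_le_im_map hf.pos hf.holomorphic hf.angularDeriv (f^[n] z)
  have hα := hf.pos
  simp only [rescaledIterate_im, Function.iterate_succ_apply']
  rw [div_le_div_iff₀ (by positivity) (by positivity), pow_succ]
  nlinarith [pow_pos hα n]

theorem IsHyperbolicAtInfty.im_le_rescaledIterate_im (hf : IsHyperbolicAtInfty f α) (n : ℕ) (z : ℍ) :
    z.im ≤ (rescaledIterate f hf.pos n z).im := by
  simpa [rescaledIterate_zero] using hf.monotone_rescaledIterate_im z n.zero_le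

/-- Julia's lemma gives `Im f^n(z) ≥ α^n Im z`, against `|f^n(z)| ≤ C α^n`; the quotient is the
aperture. -/
theorem IsHyperbolicAtInfty.tendsto_iterate_sectorAtInfty (hf : IsHyperbolicAtInfty f α) {z : ℍ} {C : ℝ}
    (hC : ∀ n, ‖(rescaledIterate f hf.pos n z : ℂ)‖ ≤ C) :
    Tendsto (fun n ↦ f^[n] z) atTop (sectorAtInfty (z.im / C)) := by
  have hα := hf.pos
  have him : ∀ n, z.im * α ^ n ≤ (f^[n] z).im := fun n ↦ by
    have := hf.im_le_rescaledIterate_im n z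
    rwa [rescaledIterate_im, le_div_iff₀ (by positivity)] at this
  refine tendsto_inf.2 ⟨tendsto_comap_iff.2 ?_, tendsto_principal.2 (Eventually.of_forall ?_)⟩
  · rw [← tendsto_norm_atTop_iff_cobounded]
    refine tendsto_atTop_mono (fun n ↦ (him n).trans ?_)
      ((tendsto_pow_atTop_atTop_of_one_lt hf.one_lt).const_mul_atTop z.im_pos)
    exact (le_abs_self _).trans (Complex.abs_im_le_norm _)
  · intro n
    have hn := hC n
    have hCpos : 0 < C := (norm_pos_iff.2 (rescaledIterate f hα n z).ne_zero).trans_le hn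
    rw [norm_rescaledIterate, div_le_iff₀ (by positivity)] at hn
    refine le_trans ?_ (him n)
    rw [div_mul_eq_mul_div, div_le_iff₀ hCpos]
    nlinarith [z.im_pos]

/-- The difference is the bounded `g_n(z)` times `f(w) / (α w) - 1` at `w = f^n(z)`, which vanishes
along sectors. -/
theorem IsHyperbolicAtInfty.tendsto_rescaledIterate_succ_sub (hf : IsHyperbolicAtInfty f α) {z : ℍ} {C : ℝ}
    (hC : ∀ n, ‖(rescaledIterate f hf.pos n z : ℂ)‖ ≤ C) :
    Tendsto (fun n ↦ (rescaledIterate f hf.pos (n + 1) z : ℂ) - rescaledIterate f hf.pos n z)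
      atTop (𝓝 0) := by
  have hα : (α : ℂ) ≠ 0 := by exact_mod_cast hf.pos.ne'
  have hCpos : 0 < C := (norm_pos_iff.2 (rescaledIterate f hf.pos 0 z).ne_zero).trans_le (hC 0)
  have h1 := (hf.angularDeriv _ (div_pos z.im_pos hCpos)).comp
    (hf.tendsto_iterate_sectorAtInfty hC)
  have h2 : Tendsto (fun n ↦ (f (f^[n] z) : ℂ) / (f^[n] z : ℂ) / α - 1) atTop (𝓝 0) := by
    simpa [hα] using (h1.div_const (α : ℂ)).sub_const 1
  refine (h2.zero_mul_isBoundedUnder_le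
    (g := fun n ↦ (rescaledIterate f hf.pos n z : ℂ)) ?_).congr fun n ↦ ?_
  · exact isBoundedUnder_of ⟨C, hC⟩
  · have hne := (f^[n] z).ne_zero
    simp only [coe_rescaledIterate, Function.iterate_succ_apply']
    field_simp
    ring

/-- A bounded orbit of rescaled iterates converges in `ℍ` once its real part is determined up to
a sign, relative to some convergent sequence. -/
theorem IsHyperbolicAtInfty.exists_tendsto_rescaledIterate (hf : IsHyperbolicAtInfty f α)
    {z : ℍ} {C : ℝ} (hC : ∀ n, ‖(rescaledIterate f hf.pos n z : ℂ)‖ ≤ C) {u : ℕ → ℝ} {u₀ : ℝ}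
    (hu : Tendsto u atTop (𝓝 u₀))
    (hsq : ∀ y, 0 < y → Tendsto (fun n ↦ (rescaledIterate f hf.pos n z).im) atTop (𝓝 y) →
      ∃ c, Tendsto (fun n ↦ ((rescaledIterate f hf.pos n z).re - u n) ^ 2) atTop (𝓝 c)) :
    ∃ l : ℍ, Tendsto (fun n ↦ rescaledIterate f hf.pos n z) atTop (𝓝 l) := by
  have him := tendsto_atTop_ciSup (hf.monotone_rescaledIterate_im z)
    ⟨C, by
      rintro _ ⟨n, rfl⟩
      exact ((le_abs_self _).trans (Complex.abs_im_le_norm _)).trans (hC n)⟩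
  set y := ⨆ n, (rescaledIterate f hf.pos n z).im
  have hy : 0 < y := z.im_pos.trans_le
    (ge_of_tendsto' him fun n ↦ hf.im_le_rescaledIterate_im n z)
  obtain ⟨c, hc⟩ := hsq y hy him
  have hd : Tendsto (fun n ↦ ((rescaledIterate f hf.pos (n + 1) z).re - u (n + 1)) -
      ((rescaledIterate f hf.pos n z).re - u n)) atTop (𝓝 0) := by
    have h1 := (Complex.continuous_re.tendsto _).comp (hf.tendsto_rescaledIterate_succ_sub hC)
    have h2 := (hu.comp (tendsto_add_atTop_nat 1)).sub hu
    have h3 := h1.sub h2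
    rw [Complex.zero_re, sub_self, sub_zero] at h3
    refine h3.congr fun n ↦ ?_
    simp only [Function.comp_apply, Complex.sub_re, coe_re]
    ring
  obtain ⟨a, ha⟩ := exists_tendsto_of_tendsto_sq hc hd
  have hre : Tendsto (fun n ↦ (rescaledIterate f hf.pos n z).re) atTop (𝓝 (a + u₀)) :=
    (ha.add hu).congr fun n ↦ sub_add_cancel _ _
  refine ⟨⟨⟨a + u₀, y⟩, hy⟩, isEmbedding_coe.tendsto_nhds_iff.2 ?_⟩
  have := ((Complex.continuous_ofReal.tendsto _).comp hre).add
    (((Complex.continuous_ofReal.tendsto _).comp him).mul_const Complex.I)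
  rw [← Complex.mk_eq_add_mul_I] at this
  exact this.congr fun n ↦ re_add_im _

end rescaledIterate

end HalfPlaneDynamics

end
noncomputable section

namespace HalfPlaneDynamics

variable {f : ℍ → ℍ} {α : ℝ}

/-! ### Convergence of the rescaled iterates -/

/-- If the rescaled iterates converge in `ℍ` at one point, then they converge at every point. -/
theorem IsHyperbolicAtInfty.exists_tendsto_rescaledIterate_of_tendsto
    (hf : IsHyperbolicAtInfty f α) {w l : ℍ}
    (hl : Tendsto (fun n ↦ rescaledIterate f hf.pos n w) atTop (𝓝 l)) (z : ℍ) :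
    ∃ l' : ℍ, Tendsto (fun n ↦ rescaledIterate f hf.pos n z) atTop (𝓝 l') := by
  set F := fun n z ↦ rescaledIterate f hf.pos n z with hF
  obtain ⟨C, hC⟩ := ((continuous_coe.tendsto l).comp hl).norm.bddAbove_range
  have hC' : ∀ n, ‖(F n w : ℂ)‖ ≤ C := fun n ↦ hC ⟨n, rfl⟩
  -- `F n z` stays within hyperbolic distance `dist z w` of `F n w`, hence within Euclidean distance
  -- `Im (F n w) * (exp (dist z w) - 1)`.
  have hbound : ∀ n, ‖(F n z : ℂ)‖ ≤ C + C * (Real.exp (dist z w) - 1) := fun n ↦ by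
    have h1 : ‖(F n z : ℂ) - F n w‖ ≤ (F n w).im * (Real.exp (dist (F n z) (F n w)) - 1) := by
      rw [← dist_eq_norm]
      exact UpperHalfPlane.dist_coe_le _ _
    have h2 : (F n w).im ≤ C := ((le_abs_self _).trans (Complex.abs_im_le_norm _)).trans (hC' n)
    have h3 : Real.exp (dist (F n z) (F n w)) ≤ Real.exp (dist z w) :=
      Real.exp_le_exp.2 (hf.dist_rescaledIterate_le n z w)
    have h4 : 1 ≤ Real.exp (dist (F n z) (F n w)) := Real.one_le_exp dist_nonneg
    have h5 : ‖(F n z : ℂ)‖ ≤ ‖(F n w : ℂ)‖ + ‖(F n z : ℂ) - F n w‖ := by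
      simpa using norm_add_le (F n w : ℂ) ((F n z : ℂ) - F n w)
    have h6 := mul_le_mul h2 (sub_le_sub_right h3 1) (by linarith)
      ((F n w).im_pos.le.trans h2)
    linarith [hC' n]
  refine hf.exists_tendsto_rescaledIterate hbound ((continuous_re.tendsto l).comp hl)
    fun y _ hy ↦ ?_
  have hdist := tendsto_atTop_ciInf (hf.antitone_dist_rescaledIterate z w)
    ⟨0, by rintro _ ⟨n, rfl⟩; exact dist_nonneg⟩
  have him := (continuous_im.tendsto l).comp hl
  -- The `cosh` distance formula, solved for the squared difference of the real parts.
  refine ⟨_, (((((hy.const_mul 2).mul him).mul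
    ((Real.continuous_cosh.tendsto _).comp hdist)).sub (hy.pow 2)).sub (him.pow 2)).congr
    fun n ↦ ?_⟩
  have h1 := (F n z).im_ne_zero
  have h2 := (F n w).im_ne_zero
  simp only [hF] at h1 h2
  simp only [Function.comp_apply, UpperHalfPlane.cosh_dist']
  field_simp
  ring

/-- Pointwise convergence of the rescaled iterates is locally uniform. -/
theorem IsHyperbolicAtInfty.tendsto_prod_rescaledIterate (hf : IsHyperbolicAtInfty f α) {w l : ℍ}
    (hl : Tendsto (fun n ↦ rescaledIterate f hf.pos n w) atTop (𝓝 l)) :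
    Tendsto (fun p : ℕ × ℍ ↦ rescaledIterate f hf.pos p.1 p.2) (atTop ×ˢ 𝓝 w) (𝓝 l) := by
  rw [tendsto_iff_dist_tendsto_zero] at hl ⊢
  have h1 : Tendsto (fun p : ℕ × ℍ ↦ dist p.2 w) (atTop ×ˢ 𝓝 w) (𝓝 0) :=
    (tendsto_iff_dist_tendsto_zero.1 tendsto_id).comp tendsto_snd
  refine squeeze_zero (fun _ ↦ dist_nonneg) (fun p ↦ ?_)
    (by simpa using h1.add (hl.comp tendsto_fst))
  exact (dist_triangle _ (rescaledIterate f hf.pos p.1 w) _).trans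
    (add_le_add_left (hf.dist_rescaledIterate_le _ _ _) _)

theorem tendstoLocallyUniformly_of_tendsto_prod {X ι E : Type*} [TopologicalSpace X]
    [UniformSpace E] {p : Filter ι} {G : ι → X → E} {g : X → E} (hg : Continuous g)
    (h : ∀ x, Tendsto (fun q : ι × X ↦ G q.1 q.2) (p ×ˢ 𝓝 x) (𝓝 (g x))) :
    TendstoLocallyUniformly G g p := by
  refine tendstoLocallyUniformly_iff_forall_tendsto.2 fun x ↦ ?_
  exact (((hg.tendsto x).comp tendsto_snd).prodMk_nhds (h x)).mono_right
    (nhds_le_uniformity (g x))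

/-- The limit of the rescaled iterates, divided by its modulus at `i`, is the Koenigs function. -/
theorem IsHyperbolicAtInfty.isKoenigsFunction (hf : IsHyperbolicAtInfty f α) {h L : ℍ → ℍ}
    (hL : IsRateFunction f α L)
    (hh : ∀ z, (h z : ℂ) = (L z : ℂ) / (‖(L UpperHalfPlane.I : ℂ)‖ : ℂ)) :
    IsKoenigsFunction f h := by
  have hlim : ∀ z, Tendsto (fun n ↦ rescaledIterate f hf.pos n z) atTop (𝓝 (L z)) := fun z ↦
    (tendsto_rescaledIterate_iff hf.pos).2 (hL z)
  -- A pointwise limit of nonexpanding maps is 1-Lipschitz.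
  have hLcont : Continuous L := by
    refine LipschitzWith.continuous (K := 1) (LipschitzWith.of_dist_le_mul fun z w ↦ ?_)
    rw [NNReal.coe_one, one_mul]
    exact le_of_tendsto' ((hlim z).dist (hlim w)) fun n ↦ hf.dist_rescaledIterate_le n z w
  have hne : (‖(L UpperHalfPlane.I : ℂ)‖ : ℂ) ≠ 0 := by
    exact_mod_cast norm_ne_zero_iff.2 (L UpperHalfPlane.I).ne_zero
  refine tendstoLocallyUniformly_of_tendsto_prod ?_ fun z ↦ ?_
  · simp only [hh]
    exact (continuous_coe.comp hLcont).div_const _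
  · have h1 := (continuous_coe.tendsto _).comp (hf.tendsto_prod_rescaledIterate (hlim z))
    have h2 : Tendsto
        (fun q : ℕ × ℍ ↦ (‖(rescaledIterate f hf.pos q.1 UpperHalfPlane.I : ℂ)‖ : ℂ))
        (atTop ×ˢ 𝓝 z) (𝓝 (‖(L UpperHalfPlane.I : ℂ)‖ : ℂ)) :=
      (Complex.continuous_ofReal.tendsto _).comp
        (((continuous_coe.tendsto _).comp (hlim UpperHalfPlane.I)).norm.comp tendsto_fst)
    rw [hh]
    refine (h1.div h2 hne).congr fun q ↦ ?_
    have hα : (α : ℂ) ^ q.1 ≠ 0 := pow_ne_zero _ (by exact_mod_cast hf.pos.ne')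
    simp only [norm_rescaledIterate, Complex.ofReal_div, Complex.ofReal_pow]
    rw [Pi.div_apply, Function.comp_apply, coe_rescaledIterate, div_div_div_cancel_right₀ hα]

/-! ### The rate of escape in the hyperbolic distance -/

/-- The mean of the distances of `f^n(z)` to `i` and `-i`, divided by `α^n`. -/
def rescaledMeanDist (f : ℍ → ℍ) (α : ℝ) (n : ℕ) (z : ℍ) : ℝ :=
  (‖Complex.I - (f^[n] z : ℂ)‖ + ‖Complex.I + (f^[n] z : ℂ)‖) / 2 / α ^ n

theorem norm_I_sub_conj (w : ℂ) : ‖Complex.I - (starRingEnd ℂ) w‖ = ‖Complex.I + w‖ := by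
  rw [← Complex.norm_conj, ← norm_neg]
  simp [add_comm]

/-- This is the square of `exp (dist z w / 2) = (|z - w| + |z - conj w|) / (2 √(Im z Im w))` at `z =
i`, with `α ^ n` divided out. -/
theorem exp_two_mul_hypDist_sub (hα : 0 < α) (n : ℕ) (z : ℍ) :
    Real.exp (2 * (hypDist UpperHalfPlane.I (f^[n] z) - Real.log α / 2 * n)) =
      rescaledMeanDist f α n z ^ 2 / (rescaledIterate f hα n z).im := by
  have h1 : 2 * (hypDist UpperHalfPlane.I (f^[n] z) - Real.log α / 2 * n) =
      (2 : ℕ) * (dist UpperHalfPlane.I (f^[n] z) / 2) - n * Real.log α := by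
    rw [hypDist_eq_half_dist]
    push_cast
    ring
  have him := (f^[n] z).im_pos
  rw [h1, Real.exp_sub, Real.exp_nat_mul, Real.exp_nat_mul, Real.exp_log hα,
    UpperHalfPlane.exp_half_dist, dist_eq_norm, dist_eq_norm, coe_I, norm_I_sub_conj, I_im,
    one_mul, rescaledIterate_im, rescaledMeanDist, div_pow, mul_pow, Real.sq_sqrt him.le]
  field_simp

theorem hypDist_sub_eq (hα : 0 < α) (n : ℕ) (z : ℍ) :
    hypDist UpperHalfPlane.I (f^[n] z) - Real.log α / 2 * n =
      1 / 2 * Real.log (rescaledMeanDist f α n z ^ 2 / (rescaledIterate f hα n z).im) := by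
  rw [← exp_two_mul_hypDist_sub, Real.log_exp]
  ring

theorem norm_le_rescaledMeanDist (hα : 0 < α) (n : ℕ) (z : ℍ) :
    ‖(rescaledIterate f hα n z : ℂ)‖ ≤ rescaledMeanDist f α n z := by
  rw [norm_rescaledIterate, rescaledMeanDist]
  gcongr
  have := norm_sub_le (Complex.I + (f^[n] z : ℂ)) (Complex.I - (f^[n] z : ℂ))
  rw [add_sub_sub_cancel, ← two_mul, norm_mul, Complex.norm_ofNat] at this
  linarith

theorem rescaledMeanDist_le (hα : 0 < α) (n : ℕ) (z : ℍ) :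
    rescaledMeanDist f α n z ≤ ‖(rescaledIterate f hα n z : ℂ)‖ + (α ^ n)⁻¹ := by
  rw [norm_rescaledIterate, rescaledMeanDist, ← one_div, ← add_div]
  gcongr
  have h1 := norm_sub_le Complex.I (f^[n] z : ℂ)
  have h2 := norm_add_le Complex.I (f^[n] z : ℂ)
  rw [Complex.norm_I] at h1 h2
  linarith

theorem IsHyperbolicAtInfty.tendsto_rescaledMeanDist_sub (hf : IsHyperbolicAtInfty f α) (z : ℍ) :
    Tendsto (fun n ↦ rescaledMeanDist f α n z - ‖(rescaledIterate f hf.pos n z : ℂ)‖)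
      atTop (𝓝 0) :=
  squeeze_zero (fun n ↦ sub_nonneg.2 (norm_le_rescaledMeanDist hf.pos n z))
    (fun n ↦ sub_le_iff_le_add'.2 (rescaledMeanDist_le hf.pos n z))
    (tendsto_inv_atTop_zero.comp (tendsto_pow_atTop_atTop_of_one_lt hf.one_lt))

theorem IsHyperbolicAtInfty.tendsto_hypDist_sub (hf : IsHyperbolicAtInfty f α) {z l : ℍ}
    (hl : Tendsto (fun n ↦ rescaledIterate f hf.pos n z) atTop (𝓝 l)) :
    Tendsto (fun n : ℕ ↦ hypDist UpperHalfPlane.I (f^[n] z) - Real.log α / 2 * n) atTop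
      (𝓝 (1 / 2 * Real.log (‖(l : ℂ)‖ ^ 2 / l.im))) := by
  have hnorm := ((continuous_coe.tendsto l).comp hl).norm
  have hG : Tendsto (fun n ↦ rescaledMeanDist f α n z) atTop (𝓝 ‖(l : ℂ)‖) := by
    have := (hf.tendsto_rescaledMeanDist_sub z).add hnorm
    rw [zero_add] at this
    exact this.congr fun n ↦ sub_add_cancel _ _
  have hquot := (hG.pow 2).div ((continuous_im.tendsto l).comp hl) l.im_ne_zero
  have hpos : ‖(l : ℂ)‖ ^ 2 / l.im ≠ 0 :=
    div_ne_zero (pow_ne_zero 2 (norm_ne_zero_iff.2 l.ne_zero)) l.im_ne_zero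
  refine ((hquot.log hpos).const_mul (1 / 2)).congr fun n ↦ ?_
  exact (hypDist_sub_eq hf.pos n z).symm

theorem IsHyperbolicAtInfty.exists_tendsto_rescaledIterate_of_hypDist
    (hf : IsHyperbolicAtInfty f α) {z : ℍ} {l : ℝ}
    (hl : Tendsto (fun n : ℕ ↦ hypDist UpperHalfPlane.I (f^[n] z) - Real.log α / 2 * n) atTop
      (𝓝 l)) :
    ∃ l' : ℍ, Tendsto (fun n ↦ rescaledIterate f hf.pos n z) atTop (𝓝 l') := by
  have hE := (Real.continuous_exp.tendsto _).comp (hl.const_mul 2)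
  have hE' : Tendsto (fun n ↦ rescaledMeanDist f α n z ^ 2 / (rescaledIterate f hf.pos n z).im)
      atTop (𝓝 (Real.exp (2 * l))) := hE.congr fun n ↦ exp_two_mul_hypDist_sub hf.pos n z
  obtain ⟨C, hC⟩ := hE'.bddAbove_range
  -- Both `|g_n|` and `Im g_n` are at most `M_n`, so `|g_n| ≤ M_n² / Im g_n ≤ C`.
  have hbound : ∀ n, ‖(rescaledIterate f hf.pos n z : ℂ)‖ ≤ C := fun n ↦ by
    refine le_trans ?_ (hC ⟨n, rfl⟩)
    rw [le_div_iff₀ (rescaledIterate f hf.pos n z).im_pos, sq]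
    exact mul_le_mul (norm_le_rescaledMeanDist hf.pos n z)
      (((le_abs_self _).trans (Complex.abs_im_le_norm _)).trans
        (norm_le_rescaledMeanDist hf.pos n z)) (rescaledIterate f hf.pos n z).im_pos.le
      ((norm_nonneg _).trans (norm_le_rescaledMeanDist hf.pos n z))
  refine hf.exists_tendsto_rescaledIterate hbound (tendsto_const_nhds (x := (0 : ℝ)))
    fun y _ hy ↦ ?_
  have hG : Tendsto (fun n ↦ rescaledMeanDist f α n z) atTop (𝓝 √(Real.exp (2 * l) * y)) := by
    refine (hE'.mul hy).sqrt.congr fun n ↦ ?_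
    rw [div_mul_cancel₀ _ (rescaledIterate f hf.pos n z).im_ne_zero,
      Real.sqrt_sq ((norm_nonneg _).trans (norm_le_rescaledMeanDist hf.pos n z))]
  -- `|g_n|² - (Im g_n)² = (Re g_n)²`, the case `u = 0`.
  refine ⟨_, (((hG.sub (hf.tendsto_rescaledMeanDist_sub z)).pow 2).sub (hy.pow 2)).congr
    fun n ↦ ?_⟩
  rw [sub_sub_cancel, Complex.sq_norm, Complex.normSq_apply, coe_re, coe_im]
  ring

theorem norm_mul_div_sin_arg_eq {h l m : ℍ} (hh : (h : ℂ) = (l : ℂ) / (‖(m : ℂ)‖ : ℂ)) :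
    ‖(h : ℂ) * m‖ / Real.sin (Complex.arg h) = ‖(l : ℂ)‖ ^ 2 / l.im := by
  have hm : ‖(m : ℂ)‖ ≠ 0 := norm_ne_zero_iff.2 m.ne_zero
  have hl : ‖(l : ℂ)‖ ≠ 0 := norm_ne_zero_iff.2 l.ne_zero
  have hi := l.im_ne_zero
  rw [Complex.sin_arg, hh, Complex.div_ofReal_im, norm_mul, norm_div, Complex.norm_real, norm_norm,
    coe_im]
  field_simp

end HalfPlaneDynamics

end

theorem theorem7p1 (f : ℍ → ℍ) (α : ℝ) (hf : HalfPlaneDynamics.IsHyperbolicAtInfty f α) :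
    (HalfPlaneDynamics.IsExtremalRate f α ↔
      ∀ z : ℍ, ∃ l : ℝ,
        Tendsto (fun n : ℕ => HalfPlaneDynamics.hypDist UpperHalfPlane.I (f^[n] z)
          - Real.log α / 2 * n) atTop (𝓝 l)) ∧
    (HalfPlaneDynamics.IsExtremalRate f α →
      ∃ h L : ℍ → ℍ,
        HalfPlaneDynamics.IsKoenigsFunction f h ∧
        HalfPlaneDynamics.IsRateFunction f α L ∧
        ∀ z : ℍ,
          Tendsto (fun n : ℕ => HalfPlaneDynamics.hypDist UpperHalfPlane.I (f^[n] z)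
            - Real.log α / 2 * n) atTop
            (𝓝 (1 / 2 * Real.log
              (‖(h z : ℂ) * (L UpperHalfPlane.I : ℂ)‖ / Real.sin (Complex.arg (h z : ℂ)))))) := by
  have hall : HalfPlaneDynamics.IsExtremalRate f α → ∀ z, ∃ l : ℍ,
      Tendsto (fun n ↦ HalfPlaneDynamics.rescaledIterate f hf.pos n z) atTop (𝓝 l) := by
    rintro ⟨w, l, hl⟩
    exact hf.exists_tendsto_rescaledIterate_of_tendsto
      ((HalfPlaneDynamics.tendsto_rescaledIterate_iff hf.pos).2 hl)
  refine ⟨⟨fun hext z ↦ ?_, fun h ↦ ?_⟩, fun hext ↦ ?_⟩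
  · obtain ⟨l, hl⟩ := hall hext z
    exact ⟨_, hf.tendsto_hypDist_sub hl⟩
  -- The distance limit at a single point suffices here.
  · obtain ⟨l, hl⟩ := h UpperHalfPlane.I
    obtain ⟨l', hl'⟩ := hf.exists_tendsto_rescaledIterate_of_hypDist hl
    exact ⟨_, l', (HalfPlaneDynamics.tendsto_rescaledIterate_iff hf.pos).1 hl'⟩
  · choose L hL using hall hext
    have hpos : 0 < ‖(L UpperHalfPlane.I : ℂ)‖⁻¹ :=
      inv_pos.2 (norm_pos_iff.2 (L UpperHalfPlane.I).ne_zero)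
    let h : ℍ → ℍ := fun z ↦ (⟨_, hpos⟩ : {x : ℝ // 0 < x}) • L z
    have hh : ∀ z, (h z : ℂ) = (L z : ℂ) / (‖(L UpperHalfPlane.I : ℂ)‖ : ℂ) := fun z ↦ by
      rw [coe_pos_real_smul, Complex.real_smul, Complex.ofReal_inv, div_eq_inv_mul]
    have hrate : HalfPlaneDynamics.IsRateFunction f α L := fun z ↦
      (HalfPlaneDynamics.tendsto_rescaledIterate_iff hf.pos).1 (hL z)
    refine ⟨h, L, hf.isKoenigsFunction hrate hh, hrate, fun z ↦ ?_⟩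
    rw [HalfPlaneDynamics.norm_mul_div_sin_arg_eq (hh z)]
    exact hf.tendsto_hypDist_sub (hL z)
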